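/- **Theorem (Abstract semi-discrete error estimate).** Let $V\subset H=H'\subset V'$ be a Gelfand triple of real Hilbert spaces (i.e. $V$ is continuously and densely embedded in $H$, and $h\in H$ is identified with the functional $(h,\cdot)$ on $V$), with inner product $(\cdot,\cdot)$ and norm $\|\cdot\|$ on $H$. Let $T>0$, $f\in H$, $u_0\in V$, and let $a:V\times V\to\mathbb R$ be a continuous and coercive (not necessarily symmetric) bilinear form. Let $\widetilde V\subseteq H$ be a finite-dimensional subspace, not necessarily contained in $V$; let $a_h:(V+\widetilde V)\times(V+\widetilde V)\to\mathbb R$ be a bilinear form that coincides with $a$ on $V\times V$; and let $|||\cdot|||$ be a norm on $V+\widetilde V$ with $|||v|||=a_h(v,v)^{1/2}$ for $v\in V$. For $\varphi\in V'$ put $|||\varphi|||_{V,-1}:=\sup_{0\neq v\in V}|\varphi(v)|/|||v|||$, and let $\gamma_h$ be the continuity constant of $a_h$ on $V$, i.e. the smallest $\gamma\ge 0$ with $|a_h(v,w)|\le\gamma\,|||v|||\,|||w|||$ for all $v,w\in V$. Let $u\in L^2(0,T;V)$ with $\partial_t u\in L^2(0,T;V')$ satisfy $u(0)=u_0$ and,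 for almost every $t\in(0,T)$, $$\langle\partial_t u(t),v\rangle+a(u(t),v)=(f,v)\qquad\text{for all }v\in V,$$ and let $\tilde u\in L^2(0,T;\widetilde V)$ with $\partial_t\tilde u\in L^2(0,T;\widetilde V)$ satisfy, for almost every $t\in(0,T)$, $$(\partial_t\tilde u(t),\tilde v)+a_h(\tilde u(t),\tilde v)=(f,\tilde v)\qquad\text{for all }\tilde v\in\widetilde V.$$ Let $\tilde u(t)=\tilde u^c(t)+\tilde u^d(t)$ be a decomposition with $\tilde u^c(t)\in V$, $\tilde u^d(t)\in\widetilde V$, where $\tilde u^d\in L^2(0,T;\widetilde V)$ and $\partial_t\tilde u^d\in L^2(0,T;V')$. Time derivatives are weak ones, and values at $t=0$ are those of the representatives in $C([0,T];H)$. For $\tilde v\in\widetilde V$ let $A_h(\tilde v)\in\widetilde V$ be defined by $(A_h(\tilde v),\tilde v')=a_h(\tilde v,\tilde v')$ for all $\tilde v'\in\widetilde V$, let $\widetilde\Pi$ be the $H$-orthogonal projection onto $\widetilde V$, and let the elliptic reconstruction $\mathcal R_{\rm ell}(\tilde v)\in V$ be the unique solution of $$a_h(\mathcal R_{\rm ell}(\tilde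 v),v)=(A_h(\tilde v)-\widetilde\Pi f+f,\,v)\qquad\text{for all }v\in V.$$ Put $e:=u-\tilde u$, $e^c:=u-\tilde u^c$, $\varepsilon:=\mathcal R_{\rm ell}(\tilde u)-\tilde u$ and $C:=(2\gamma_h^2+1)^{1/2}$. Then $$\|e\|_{L^2(0,T;|||\cdot|||)}\le\|e^c(0)\|+\sqrt3\,\|\partial_t\tilde u^d\|_{L^2(0,T;|||\cdot|||_{V,-1})}+(C+1)\,\|\varepsilon\|_{L^2(0,T;|||\cdot|||)}+C\,\|\tilde u^d\|_{L^2(0,T;|||\cdot|||)}.$$ -/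

import Mathlib

open MeasureTheory Set
open scoped ContDiff ENNReal RealInnerProductSpace

noncomputable section

namespace ParabolicEstimate

/-! ### Bochner-space notions on the time interval `(0, T)` -/

/-- Lebesgue measure on the time interval `(0, T)`. -/
def timeMeasure (T : ℝ) : Measure ℝ := volume.restrict (Ioo 0 T)

/-- `g` is the weak (distributional) time derivative of `w` on `(0, T)`, both with values in `E`:
`∫ φ' w = - ∫ φ g` for all test functions `φ ∈ C_c^∞(0, T)`.
It is used only for square-integrable `w` and `g`. -/
def HasWeakTimeDeriv {E : Type*} [NormedAddCommGroup E] [NormedSpace ℝ E]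
    (T : ℝ) (w g : ℝ → E) : Prop :=
  ∀ φ : ℝ → ℝ, ContDiff ℝ ∞ φ → HasCompactSupport φ → tsupport φ ⊆ Ioo 0 T →
    ∫ t, deriv φ t • w t ∂(timeMeasure T) = - ∫ t, φ t • g t ∂(timeMeasure T)

/-- `w(0) = w₀`, understood, as usual, for the representative of `w` in `C([0, T]; E)`. -/
def HasInitialValue {E : Type*} [NormedAddCommGroup E] (T : ℝ) (w : ℝ → E) (w₀ : E) : Prop :=
  ∃ wc : ℝ → E, ContinuousOn wc (Icc 0 T) ∧ wc =ᵐ[timeMeasure T] w ∧ wc 0 = w₀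

/-! ### The abstract setting -/

/-- The Gelfand triple `V ⊂ H = H' ⊂ V'`, the elliptic form `a` on `V`, the finite-dimensional
approximation space `Ṽ ⊆ H`, and the discrete form `a_h` and energy norm on `V + Ṽ ⊆ H`. -/
structure Setting (V H : Type*) [NormedAddCommGroup V] [InnerProductSpace ℝ V] [CompleteSpace V]
    [NormedAddCommGroup H] [InnerProductSpace ℝ H] [CompleteSpace H] where
  /-- the continuous dense embedding `V ⊂ H` -/
  ι : V →L[ℝ] H
  ι_injective : Function.Injective ι
  ι_dense : DenseRange ι
  /-- the continuous coercive (not necessarily symmetric) bilinear form on `V` -/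
  a : V →L[ℝ] V →L[ℝ] ℝ
  a_coercive : IsCoercive a
  /-- the approximation space `Ṽ`, not necessarily contained in `V` -/
  Vt : Submodule ℝ H
  finiteDimensional_Vt : FiniteDimensional ℝ Vt
  /-- the discrete bilinear form `a_h` on `V + Ṽ` -/
  ah : ↥(ι.range ⊔ Vt) →ₗ[ℝ] ↥(ι.range ⊔ Vt) →ₗ[ℝ] ℝ
  /-- `a_h` coincides with `a` on `V × V` -/
  ah_eq : ∀ (v w : V) (x y : ↥(ι.range ⊔ Vt)), (x : H) = ι v → (y : H) = ι w → ah x y = a v w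
  /-- the energy norm on `V + Ṽ` -/
  energy : Seminorm ℝ ↥(ι.range ⊔ Vt)
  energy_definite : ∀ x, energy x = 0 → x = 0
  /-- on `V` the energy norm is the square root of (the symmetric part of) `a_h` -/
  energy_eq : ∀ (v : V) (x : ↥(ι.range ⊔ Vt)), (x : H) = ι v → energy x = √(ah x x)

attribute [instance] Setting.finiteDimensional_Vt

namespace Setting

variable {V H : Type*} [NormedAddCommGroup V] [InnerProductSpace ℝ V] [CompleteSpace V]
  [NormedAddCommGroup H] [InnerProductSpace ℝ H] [CompleteSpace H] (S : Setting V H)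

/-- The space `V + Ṽ`, as a subspace of `H`. -/
abbrev Sum : Submodule ℝ H := S.ι.range ⊔ S.Vt

/-- The inclusion `V ⊂ V + Ṽ`. -/
def inV : V →ₗ[ℝ] S.Sum :=
  LinearMap.codRestrict S.Sum S.ι.toLinearMap fun v => Submodule.mem_sup_left ⟨v, rfl⟩

/-- The inclusion `Ṽ ⊂ V + Ṽ`. -/
def inVt : S.Vt →ₗ[ℝ] S.Sum := Submodule.inclusion le_sup_right

/-- The embedding `H = H' ⊂ V'` of the Gelfand triple, `h ↦ (h, ·)`. -/
def toDualV : H →L[ℝ] StrongDual ℝ V := (innerSL ℝ).bilinearComp (.id ℝ H) S.ι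

/-- The dual energy norm `|||φ|||_{V,-1} = sup_{v ∈ V, v ≠ 0} |φ(v)| / |||v|||`
(the term `v = 0` contributes `0`). -/
def dualEnergy (φ : StrongDual ℝ V) : ℝ := ⨆ v : V, |φ v| / S.energy (S.inV v)

/-- The continuity constant `γ_h` of `a_h` on `V` with respect to the energy norm. -/
def gamma : ℝ :=
  sInf {γ : ℝ | 0 ≤ γ ∧ ∀ v w : V,
    |S.ah (S.inV v) (S.inV w)| ≤ γ * S.energy (S.inV v) * S.energy (S.inV w)}

/-- `A_h(ṽ) ∈ Ṽ`, the Riesz representative in `(Ṽ, (·,·)_H)` of `a_h(ṽ, ·)`. -/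
def Ah (v : S.Vt) : S.Vt :=
  (InnerProductSpace.toDual ℝ S.Vt).symm
    (LinearMap.toContinuousLinearMap ((S.ah (S.inVt v)).comp S.inVt))

/-- The elliptic reconstruction `R_ell(ṽ) ∈ V`: the solution, given by the Lax-Milgram theorem, of
`a_h(R_ell(ṽ), v) = (A_h(ṽ) - Π̃ f + f, v)` for all `v ∈ V`, where `Π̃` is the `H`-orthogonal
projection onto `Ṽ`. -/
def ellRec (f : H) (vt : S.Vt) : V :=
  S.a_coercive.continuousLinearEquivOfBilin.symm
    (S.ι.adjoint ((S.Ah vt : H) - S.Vt.starProjection f + f))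

/-- `u` is a weak solution: `u ∈ L²(0,T;V)`, `∂ₜu ∈ L²(0,T;V')`, `u(0) = u₀`, and
`⟨∂ₜu(t), v⟩ + a(u(t), v) = (f, v)` for all `v ∈ V` and almost every `t`. -/
def IsWeakSolution (T : ℝ) (f : H) (u₀ : V) (u : ℝ → V) : Prop :=
  MemLp u 2 (timeMeasure T) ∧ HasInitialValue T (fun t => S.ι (u t)) (S.ι u₀) ∧
  ∃ u' : ℝ → StrongDual ℝ V, MemLp u' 2 (timeMeasure T) ∧
    HasWeakTimeDeriv T (fun t => S.toDualV (S.ι (u t))) u' ∧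
    ∀ᵐ t ∂(timeMeasure T), ∀ v : V, u' t v + S.a (u t) v = ⟪f, S.ι v⟫

/-- `ũ` is a `Ṽ`-Galerkin approximation: `ũ, ∂ₜũ ∈ L²(0,T;Ṽ)`, and
`(∂ₜũ(t), ṽ) + a_h(ũ(t), ṽ) = (f, ṽ)` for all `ṽ ∈ Ṽ` and almost every `t`. -/
def IsGalerkinSolution (T : ℝ) (f : H) (ut : ℝ → S.Vt) : Prop :=
  MemLp ut 2 (timeMeasure T) ∧
  ∃ ut' : ℝ → S.Vt, MemLp ut' 2 (timeMeasure T) ∧ HasWeakTimeDeriv T ut ut' ∧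
    ∀ᵐ t ∂(timeMeasure T), ∀ v : S.Vt,
      ⟪(ut' t : H), (v : H)⟫ + S.ah (S.inVt (ut t)) (S.inVt v) = ⟪f, (v : H)⟫

/-- `‖w‖_{L²(0,T;|||·|||)}` for a function `w` with values in `V + Ṽ`. -/
def energyL2 (T : ℝ) (w : ℝ → S.Sum) : ℝ≥0∞ :=
  eLpNorm (fun t => S.energy (w t)) 2 (timeMeasure T)

/-- `‖g‖_{L²(0,T;|||·|||_{V,-1})}` for a function `g` with values in `V'`. -/
def dualEnergyL2 (T : ℝ) (g : ℝ → StrongDual ℝ V) : ℝ≥0∞ :=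
  eLpNorm (fun t => S.dualEnergy (g t)) 2 (timeMeasure T)

@[simp]
theorem coe_inV (v : V) : (S.inV v : H) = S.ι v := rfl

@[simp]
theorem coe_inVt (v : S.Vt) : (S.inVt v : H) = v := rfl

@[simp]
theorem toDualV_apply (h : H) (v : V) : S.toDualV h v = ⟪h, S.ι v⟫ := rfl

theorem inner_Ah (v w : S.Vt) : ⟪(S.Ah v : H), (w : H)⟫ = S.ah (S.inVt v) (S.inVt w) := by
  rw [← Submodule.coe_inner, Ah, InnerProductSpace.toDual_symm_apply]
  rfl

/-- `ellRec` solves its defining variational problem, and is its only solution. -/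
theorem eq_ellRec_iff (f : H) (vt : S.Vt) (r : V) :
    r = S.ellRec f vt ↔ ∀ v : V, S.ah (S.inV r) (S.inV v) =
      ⟪(S.Ah vt : H) - S.Vt.starProjection f + f, S.ι v⟫ := by
  have key : ∀ v : V, S.ah (S.inV r) (S.inV v) =
      ⟪S.a_coercive.continuousLinearEquivOfBilin r, v⟫ := fun v => by
    rw [IsCoercive.continuousLinearEquivOfBilin_apply, S.ah_eq r v _ _ rfl rfl]
  simp only [key, ← ContinuousLinearMap.adjoint_inner_left]
  rw [ellRec, ContinuousLinearEquiv.eq_symm_apply]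
  exact ⟨fun h v => by rw [h], fun h => ext_inner_right ℝ h⟩

end Setting

end ParabolicEstimate

end

/-! Write `e = ρ + ε` with `ρ = u - R_ell(ũ)` in `V`. The Galerkin equation says `∂ₜũ = Π̃ f -
A_h(ũ)`, so the load in the definition of `R_ell(ũ)` is exactly `f - ∂ₜũ`. Subtracting from the
equation for `u` cancels `f` and leaves `⟨∂ₜeᶜ, v⟩ + a(ρ, v) = ⟨∂ₜũᵈ, v⟩` for all `v ∈ V`
(`error_equation`).

The error `e` need not lie in `V`, but `eᶜ = ρ + (R_ell(ũ) - ũᶜ)` does, and is used as test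
function. Continuity of `a` and Young's inequality give a pointwise bound for `2 ⟨∂ₜeᶜ, eᶜ⟩ +
|||ρ|||²` (`two_mul_apply_add_sq_energy_le`). After integration in time the first term is at least
`-‖eᶜ(0)‖²`, which bounds `ρ`; finally `R_ell(ũ) - ũᶜ = ε + ũᵈ`.

The analytic core is this lower bound, `neg_sq_norm_le_integral`, a one-sided form of the
Lions-Magenes integration by parts formula. It is proved with difference quotients: the fundamental
theorem of calculus for weak derivatives, Fubini, and the `L²` continuity of translations. -/

noncomputable section

namespace ParabolicEstimate

open Filter Topology

/-! ### Weak time derivatives and the fundamental theorem of calculus. -/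

section WeakDerivative

variable {E : Type*} [NormedAddCommGroup E] [NormedSpace ℝ E]

/-- Averaging against the rescaled derivative of `Real.smoothTransition` recovers the value of a
continuous function at a point, from the right. -/
theorem tendsto_integral_deriv_smoothTransition [CompleteSpace E] {T s : ℝ} {F : ℝ → E}
    (hF : ContinuousOn F (Icc 0 T)) (hs : 0 < s) (hsT : s < T) :
    Tendsto (fun n : ℕ => ∫ r in Ioo 0 T,
      (deriv Real.smoothTransition (((n : ℝ) + 1) * (r - s)) * ((n : ℝ) + 1)) • F r)
      atTop (𝓝 (F s)) := by
  set θ := Real.smoothTransition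
  have hθ : ContDiff ℝ 1 θ := Real.smoothTransition.contDiff (n := 1)
  have hθ' : Continuous (deriv θ) := hθ.continuous_deriv le_rfl
  have hθ0 : ∀ x, x ≤ 0 → deriv θ x = 0 := by
    intro x hx
    have : EqOn θ (fun _ => 0) (Iic x) := fun y hy =>
      Real.smoothTransition.zero_of_nonpos (le_trans hy hx)
    have h1 := (hasDerivWithinAt_const x (Iic x) (0 : ℝ)).congr this (this self_mem_Iic)
    have h2 := ((hθ.differentiable one_ne_zero) x).hasDerivAt.hasDerivWithinAt (s := Iic x)
    exact (uniqueDiffWithinAt_Iic x).eq_deriv _ h2 h1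
  have hθ1 : ∀ x, 1 ≤ x → deriv θ x = 0 := by
    intro x hx
    have : EqOn θ (fun _ => 1) (Ici x) := fun y hy =>
      Real.smoothTransition.one_of_one_le (le_trans hx hy)
    have h1 := (hasDerivWithinAt_const x (Ici x) (1 : ℝ)).congr this (this self_mem_Ici)
    have h2 := ((hθ.differentiable one_ne_zero) x).hasDerivAt.hasDerivWithinAt (s := Ici x)
    exact (uniqueDiffWithinAt_Ici x).eq_deriv _ h2 h1
  -- This is the claim after the substitution `x = (n + 1) (r - s)`. The kernel `θ'` lives on `[0,
  -- 1]` and has integral `θ 1 - θ 0 = 1`, so dominated convergence applies.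
  have hlim : Tendsto (fun n : ℕ => ∫ x in (0 : ℝ)..1, deriv θ x • F (s + x / ((n : ℝ) + 1)))
      atTop (𝓝 (F s)) := by
    have hone : ∫ x in (0 : ℝ)..1, deriv θ x • F s = F s := by
      rw [intervalIntegral.integral_smul_const, intervalIntegral.integral_deriv_eq_sub
        (fun x _ => (hθ.differentiable one_ne_zero) x) (hθ'.intervalIntegrable _ _)]
      simp [θ, Real.smoothTransition.zero, Real.smoothTransition.one]
    obtain ⟨M, hM⟩ := isCompact_Icc.exists_bound_of_continuousOn hF
    have hmem : ∀ᶠ n : ℕ in atTop, ∀ x ∈ Icc (0 : ℝ) 1, s + x / ((n : ℝ) + 1) ∈ Icc 0 T := by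
      have : Tendsto (fun n : ℕ => s + 1 / ((n : ℝ) + 1)) atTop (𝓝 (s + 0)) :=
        tendsto_const_nhds.add tendsto_one_div_add_atTop_nhds_zero_nat
      rw [add_zero] at this
      filter_upwards [this.eventually_lt_const hsT] with n hn x hx
      have hn1 : (0 : ℝ) < n + 1 := by positivity
      have h1 : x / ((n : ℝ) + 1) ≤ 1 / ((n : ℝ) + 1) := by gcongr; exact hx.2
      have h2 : 0 ≤ x / ((n : ℝ) + 1) := div_nonneg hx.1 hn1.le
      exact ⟨by linarith, by linarith⟩
    rw [← hone]
    refine intervalIntegral.tendsto_integral_filter_of_dominated_convergence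
      (fun x => |deriv θ x| * M) ?_ ?_ ?_ ?_
    · filter_upwards [hmem] with n hn
      have hc : ContinuousOn (fun x : ℝ => deriv θ x • F (s + x / ((n : ℝ) + 1))) (Icc 0 1) :=
        hθ'.continuousOn.smul (hF.comp (by fun_prop) hn)
      rw [uIoc_of_le zero_le_one]
      exact (hc.mono Ioc_subset_Icc_self).aestronglyMeasurable measurableSet_Ioc
    · filter_upwards [hmem] with n hn
      refine .of_forall fun x hx => ?_
      rw [uIoc_of_le zero_le_one] at hx
      rw [norm_smul, Real.norm_eq_abs]
      gcongr
      exact hM _ (hn x (Ioc_subset_Icc_self hx))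
    · exact (hθ'.abs.mul continuous_const).intervalIntegrable _ _
    · refine .of_forall fun x hx => ?_
      have hat : ContinuousAt F s := hF.continuousAt (Icc_mem_nhds hs hsT)
      have : Tendsto (fun n : ℕ => s + x / ((n : ℝ) + 1)) atTop (𝓝 s) := by
        have := (tendsto_one_div_add_atTop_nhds_zero_nat (𝕜 := ℝ)).const_mul x
        simpa [div_eq_mul_inv] using this.const_add s
      exact (hat.tendsto.comp this).const_smul _
  refine hlim.congr' ?_
  have hev : Tendsto (fun n : ℕ => s + 1 / ((n : ℝ) + 1)) atTop (𝓝 (s + 0)) :=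
    tendsto_const_nhds.add tendsto_one_div_add_atTop_nhds_zero_nat
  rw [add_zero] at hev
  filter_upwards [hev.eventually_lt_const hsT] with n hn
  have hn1 : (0 : ℝ) < n + 1 := by positivity
  have hsub : Ioc s (s + 1 / ((n : ℝ) + 1)) ⊆ Ioo 0 T := fun r hr =>
    ⟨hs.trans hr.1, hr.2.trans_lt hn⟩
  rw [setIntegral_eq_of_subset_of_forall_sdiff_eq_zero measurableSet_Ioo hsub,
    ← intervalIntegral.integral_of_le (by linarith [one_div_pos.2 hn1])]
  · have := intervalIntegral.smul_integral_comp_mul_sub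
      (fun x => deriv θ x • F (s + x / ((n : ℝ) + 1))) ((n : ℝ) + 1)
      (((n : ℝ) + 1) * s) (a := s) (b := s + 1 / ((n : ℝ) + 1))
    rw [sub_self, mul_add, mul_one_div_cancel hn1.ne', add_sub_cancel_left] at this
    rw [← this, ← intervalIntegral.integral_smul]
    refine intervalIntegral.integral_congr fun r _ => ?_
    rw [← mul_sub, mul_div_cancel_left₀ _ hn1.ne', smul_smul, mul_comm, add_sub_cancel]
  · intro r hr
    have : deriv θ (((n : ℝ) + 1) * (r - s)) = 0 := by
      rcases le_or_gt r s with h | h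
      · exact hθ0 _ (mul_nonpos_of_nonneg_of_nonpos hn1.le (by linarith))
      · apply hθ1
        have h3 : s + 1 / ((n : ℝ) + 1) < r := by
          by_contra hcon
          exact hr.2 ⟨h, not_lt.1 hcon⟩
        have := (mul_lt_mul_of_pos_left (show 1 / ((n : ℝ) + 1) < r - s by linarith) hn1)
        rw [mul_one_div_cancel hn1.ne'] at this
        exact this.le
    simp [this]

/-- The fundamental theorem of calculus for continuous functions with integrable weak
derivative. -/
theorem HasWeakTimeDeriv.sub_eq_integral [CompleteSpace E] {T s t : ℝ} {F g : ℝ → E}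
    (h : HasWeakTimeDeriv T F g) (hF : ContinuousOn F (Icc 0 T))
    (hg : Integrable g (timeMeasure T)) (hs : 0 < s) (hst : s < t) (htT : t < T) :
    F t - F s = ∫ r in s..t, g r := by
  set θ := Real.smoothTransition
  have hθ : ContDiff ℝ ∞ θ := Real.smoothTransition.contDiff
  -- A smoothed indicator of `(s, t]`, rising just after `s` and falling just after `t`. It is an
  -- admissible test function as soon as `t + 1/(n + 1) < T`. In the limit its derivative yields `F
  -- s - F t`.
  let φ : ℕ → ℝ → ℝ := fun n r => θ (((n : ℝ) + 1) * (r - s)) - θ (((n : ℝ) + 1) * (r - t))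
  have hφs : ∀ n, ContDiff ℝ ∞ (φ n) := fun n =>
    (hθ.comp (by fun_prop)).sub (hθ.comp (by fun_prop))
  have hφd : ∀ n r, deriv (φ n) r = deriv θ (((n : ℝ) + 1) * (r - s)) * ((n : ℝ) + 1) -
      deriv θ (((n : ℝ) + 1) * (r - t)) * ((n : ℝ) + 1) := by
    intro n r
    have key : ∀ c : ℝ, HasDerivAt (fun r => θ (((n : ℝ) + 1) * (r - c)))
        (deriv θ (((n : ℝ) + 1) * (r - c)) * ((n : ℝ) + 1)) r := fun c => by
      have h1 : HasDerivAt (fun r : ℝ => ((n : ℝ) + 1) * (r - c)) ((n : ℝ) + 1) r := by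
        simpa using ((hasDerivAt_id r).sub_const c).const_mul ((n : ℝ) + 1)
      exact ((hθ.differentiable (by simp)) _).hasDerivAt.comp r h1
    exact ((key s).sub (key t)).deriv
  have hsupp : ∀ n : ℕ, Function.support (φ n) ⊆ Icc s (t + 1 / ((n : ℝ) + 1)) := by
    intro n r hr
    have hn1 : (0 : ℝ) < n + 1 := by positivity
    by_contra hcon
    apply hr
    rw [mem_Icc, not_and_or, not_le, not_le] at hcon
    rcases hcon with hc | hc
    · have h1 : ((n : ℝ) + 1) * (r - s) ≤ 0 :=
        mul_nonpos_of_nonneg_of_nonpos hn1.le (by linarith)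
      have h2 : ((n : ℝ) + 1) * (r - t) ≤ 0 :=
        mul_nonpos_of_nonneg_of_nonpos hn1.le (by linarith)
      simp only [φ, θ]
      rw [Real.smoothTransition.zero_of_nonpos h1, Real.smoothTransition.zero_of_nonpos h2,
        sub_zero]
    · have h2 : 1 ≤ ((n : ℝ) + 1) * (r - t) := by
        have := (mul_lt_mul_of_pos_left (show 1 / ((n : ℝ) + 1) < r - t by linarith) hn1)
        rw [mul_one_div_cancel hn1.ne'] at this
        exact this.le
      have h1 : 1 ≤ ((n : ℝ) + 1) * (r - s) := h2.trans (by gcongr)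
      simp only [φ, θ]
      rw [Real.smoothTransition.one_of_one_le h1, Real.smoothTransition.one_of_one_le h2,
        sub_self]
  have hev : Tendsto (fun n : ℕ => t + 1 / ((n : ℝ) + 1)) atTop (𝓝 (t + 0)) :=
    tendsto_const_nhds.add tendsto_one_div_add_atTop_nhds_zero_nat
  rw [add_zero] at hev
  have hleft : Tendsto (fun n => ∫ r, deriv (φ n) r • F r ∂(timeMeasure T)) atTop
      (𝓝 (F s - F t)) := by
    have h1 := tendsto_integral_deriv_smoothTransition hF hs (hst.trans htT)
    have h2 := tendsto_integral_deriv_smoothTransition hF (hs.trans hst) htT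
    refine (h1.sub h2).congr fun n => ?_
    have hθ' : Continuous (deriv θ) := hθ.continuous_deriv (by simp)
    have hint : ∀ c : ℝ, IntegrableOn (fun r =>
        (deriv θ (((n : ℝ) + 1) * (r - c)) * ((n : ℝ) + 1)) • F r) (Ioo 0 T) := fun c =>
      ((Continuous.continuousOn (by fun_prop)).smul hF).integrableOn_Icc.mono_set
        Ioo_subset_Icc_self
    rw [timeMeasure, ← integral_sub (hint s) (hint t)]
    simp only [hφd, sub_smul]
  have hright : Tendsto (fun n => - ∫ r, φ n r • g r ∂(timeMeasure T)) atTop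
      (𝓝 (- ∫ r, (Ioc s t).indicator g r ∂(timeMeasure T))) := by
    refine (tendsto_integral_of_dominated_convergence (fun r => 2 * ‖g r‖) ?_
      (hg.norm.const_mul 2) ?_ ?_).neg
    · exact fun n => (hφs n).continuous.aestronglyMeasurable.smul hg.1
    · refine fun n => .of_forall fun r => ?_
      rw [norm_smul]
      gcongr
      rw [Real.norm_eq_abs, abs_le]
      have a1 := Real.smoothTransition.nonneg (((n : ℝ) + 1) * (r - s))
      have a2 := Real.smoothTransition.le_one (((n : ℝ) + 1) * (r - s))
      have a3 := Real.smoothTransition.nonneg (((n : ℝ) + 1) * (r - t))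
      have a4 := Real.smoothTransition.le_one (((n : ℝ) + 1) * (r - t))
      constructor <;> simp only [φ, θ] <;> linarith
    · refine .of_forall fun r => ?_
      have key : ∀ c : ℝ, Tendsto (fun n : ℕ => θ (((n : ℝ) + 1) * (r - c))) atTop
          (𝓝 ((Ioi c).indicator 1 r)) := by
        intro c
        rcases le_or_gt r c with hr | hr
        · rw [indicator_of_notMem (by simpa using hr)]
          refine tendsto_const_nhds.congr fun n => ?_
          exact (Real.smoothTransition.zero_of_nonpos
            (mul_nonpos_of_nonneg_of_nonpos (by positivity) (by linarith))).symm
        · rw [indicator_of_mem (by simpa using hr)]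
          refine tendsto_const_nhds.congr' ?_
          have : Tendsto (fun n : ℕ => ((n : ℝ) + 1) * (r - c)) atTop atTop :=
            (tendsto_natCast_atTop_atTop.atTop_add tendsto_const_nhds).atTop_mul_const
              (by linarith)
          filter_upwards [this.eventually_ge_atTop 1] with n hn
          exact (Real.smoothTransition.one_of_one_le hn).symm
      have := ((key s).sub (key t)).smul_const (g r)
      convert this using 2
      by_cases h1 : s < r <;> by_cases h2 : t < r
      · simp [h1, h2]
      · simp [h1, h2, not_lt.1 h2]
      · exact absurd (hst.trans h2) h1
      · simp [h1, h2]
  have heq : F s - F t = - ∫ r, (Ioc s t).indicator g r ∂(timeMeasure T) := by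
    refine tendsto_nhds_unique hleft (hright.congr' ?_)
    filter_upwards [hev.eventually_lt_const htT] with n hn
    have hts : tsupport (φ n) ⊆ Icc s (t + 1 / ((n : ℝ) + 1)) :=
      closure_minimal (hsupp n) isClosed_Icc
    exact (h (φ n) (hφs n) (HasCompactSupport.of_support_subset_isCompact isCompact_Icc (hsupp n))
      (hts.trans fun r hr => ⟨hs.trans_le hr.1, hr.2.trans_lt hn⟩)).symm
  have hI : ∫ r, (Ioc s t).indicator g r ∂(timeMeasure T) = ∫ r in s..t, g r := by
    rw [integral_indicator measurableSet_Ioc, timeMeasure,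
      Measure.restrict_restrict measurableSet_Ioc, intervalIntegral.integral_of_le hst.le,
      inter_eq_left.2 (show Ioc s t ⊆ Ioo 0 T from fun r hr => ⟨hs.trans hr.1, hr.2.trans_lt htT⟩)]
  rw [← hI, ← neg_sub (F s), heq, neg_neg]

theorem integrable_test_smul {T : ℝ} {φ : ℝ → ℝ} (hφ : Continuous φ) (hc : HasCompactSupport φ)
    {g : ℝ → E} (hg : Integrable g (timeMeasure T)) :
    Integrable (fun t => φ t • g t) (timeMeasure T) := by
  obtain ⟨M, hM⟩ := hc.exists_bound_of_continuous hφ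
  exact hg.bdd_smul M hφ.aestronglyMeasurable (.of_forall hM)

theorem HasWeakTimeDeriv.congr {T : ℝ} {w w₁ g g₁ : ℝ → E} (h : HasWeakTimeDeriv T w g)
    (hw : w =ᵐ[timeMeasure T] w₁) (hg : g =ᵐ[timeMeasure T] g₁) : HasWeakTimeDeriv T w₁ g₁ := by
  intro φ h1 h2 h3
  have e1 : ∫ t, deriv φ t • w₁ t ∂(timeMeasure T) = ∫ t, deriv φ t • w t ∂(timeMeasure T) :=
    integral_congr_ae (by filter_upwards [hw] with t ht; rw [ht])
  have e2 : ∫ t, φ t • g₁ t ∂(timeMeasure T) = ∫ t, φ t • g t ∂(timeMeasure T) :=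
    integral_congr_ae (by filter_upwards [hg] with t ht; rw [ht])
  rw [e1, e2, h φ h1 h2 h3]

theorem HasWeakTimeDeriv.add {T : ℝ} {w g w₁ g₁ : ℝ → E} (h : HasWeakTimeDeriv T w g)
    (h₁ : HasWeakTimeDeriv T w₁ g₁) (hw : Integrable w (timeMeasure T))
    (hg : Integrable g (timeMeasure T)) (hw₁ : Integrable w₁ (timeMeasure T))
    (hg₁ : Integrable g₁ (timeMeasure T)) :
    HasWeakTimeDeriv T (fun t => w t + w₁ t) (fun t => g t + g₁ t) := by
  intro φ a1 a2 a3
  have hd : Continuous (deriv φ) := a1.continuous_deriv (by simp)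
  simp only [smul_add]
  rw [integral_add (integrable_test_smul hd a2.deriv hw) (integrable_test_smul hd a2.deriv hw₁),
    integral_add (integrable_test_smul a1.continuous a2 hg)
      (integrable_test_smul a1.continuous a2 hg₁), h φ a1 a2 a3, h₁ φ a1 a2 a3, neg_add]

theorem HasWeakTimeDeriv.clm_comp {G : Type*} [NormedAddCommGroup G] [NormedSpace ℝ G]
    [CompleteSpace E] [CompleteSpace G] {T : ℝ} {w g : ℝ → E} (h : HasWeakTimeDeriv T w g)
    (L : E →L[ℝ] G) (hw : Integrable w (timeMeasure T)) (hg : Integrable g (timeMeasure T)) :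
    HasWeakTimeDeriv T (fun t => L (w t)) (fun t => L (g t)) := by
  intro φ a1 a2 a3
  have hd : Continuous (deriv φ) := a1.continuous_deriv (by simp)
  simp only [← map_smul]
  rw [L.integral_comp_comm (integrable_test_smul hd a2.deriv hw),
    L.integral_comp_comm (integrable_test_smul a1.continuous a2 hg), h φ a1 a2 a3, map_neg]

end WeakDerivative

/-! ### Continuity of translations in the duality pairing. -/

section Translation

variable {E : Type*} [NormedAddCommGroup E] [NormedSpace ℝ E]

/-- Translating both factors of the duality pairing of two square-integrable functions is
continuous in `L¹`. -/
theorem tendsto_integral_abs_translate_pairing {g : ℝ → StrongDual ℝ E} {w : ℝ → E}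
    (hg : MemLp g 2 volume) (hw : MemLp w 2 volume) :
    Tendsto (fun p : ℝ × ℝ => ∫ t, |g (t + p.1) (w (t + p.2)) - g t (w t)|) (𝓝 0) (𝓝 0) := by
  let τ : ℝ → C(ℝ, ℝ) := fun h => ⟨fun t => t + h, by fun_prop⟩
  have hτ : Continuous τ := by
    refine ContinuousMap.continuous_of_continuous_uncurry _ ?_
    change Continuous fun p : ℝ × ℝ => p.2 + p.1
    fun_prop
  have hτm : ∀ h, MeasurePreserving (τ h) := fun h => measurePreserving_add_right volume h
  let B : StrongDual ℝ E →L[ℝ] E →L[ℝ] ℝ := ContinuousLinearMap.id ℝ _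
  -- Translation acts continuously on `L²`, and the Hölder pairing `L² × L² → L¹` is continuous.
  -- Hence `Φ` is a continuous map into `L¹`, and the integral in question is `‖Φ p - Φ 0‖`.
  let Φ : ℝ × ℝ → Lp ℝ 1 (volume : Measure ℝ) := fun p =>
    B.holderL volume 2 2 1 (Lp.compMeasurePreserving (τ p.1) (hτm p.1) (hg.toLp g))
      (Lp.compMeasurePreserving (τ p.2) (hτm p.2) (hw.toLp w))
  have hΦ : Continuous Φ := by
    have h1 : Continuous fun p : ℝ × ℝ =>
        Lp.compMeasurePreserving (τ p.1) (hτm p.1) (hg.toLp g) :=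
      continuous_const.compMeasurePreservingLp (hτ.comp continuous_fst) (fun p => hτm p.1)
        (by simp)
    have h2 : Continuous fun p : ℝ × ℝ =>
        Lp.compMeasurePreserving (τ p.2) (hτm p.2) (hw.toLp w) :=
      continuous_const.compMeasurePreservingLp (hτ.comp continuous_snd) (fun p => hτm p.2)
        (by simp)
    exact ((B.holderL volume 2 2 1).continuous.comp h1).clm_apply h2
  have hcoe : ∀ p : ℝ × ℝ, Φ p =ᵐ[volume] fun t => g (t + p.1) (w (t + p.2)) := by
    intro p
    have h1 := Lp.coeFn_compMeasurePreserving (hg.toLp g) (hτm p.1)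
    have h2 := Lp.coeFn_compMeasurePreserving (hw.toLp w) (hτm p.2)
    have h3 := (hτm p.1).quasiMeasurePreserving.ae_eq_comp hg.coeFn_toLp
    have h4 := (hτm p.2).quasiMeasurePreserving.ae_eq_comp hw.coeFn_toLp
    filter_upwards [B.coeFn_holder (r := 1)
      (Lp.compMeasurePreserving (τ p.1) (hτm p.1) (hg.toLp g))
      (Lp.compMeasurePreserving (τ p.2) (hτm p.2) (hw.toLp w)), h1, h2, h3, h4]
      with t a0 a1 a2 a3 a4
    refine a0.trans ?_
    rw [a1, a2, a3, a4]
    rfl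
  have hlim : Tendsto (fun p => ‖Φ p - Φ 0‖) (𝓝 0) (𝓝 0) := by
    have := (hΦ.sub (continuous_const (y := Φ 0))).norm.tendsto (0 : ℝ × ℝ)
    simpa using this
  refine hlim.congr fun p => ?_
  rw [L1.norm_eq_integral_norm]
  refine integral_congr_ae ?_
  filter_upwards [Lp.coeFn_sub (Φ p) (Φ 0), hcoe p, hcoe 0] with t h1 h2 h3
  rw [h1, Pi.sub_apply, h2, h3, Real.norm_eq_abs]
  simp

theorem integrable_translate_pairing {g : ℝ → StrongDual ℝ E} {w : ℝ → E}
    (hg : MemLp g 2 volume) (hw : MemLp w 2 volume) (r h : ℝ) :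
    Integrable (fun t => g (t + r) (w (t + h))) := by
  have h1 := hg.comp_measurePreserving (measurePreserving_add_right volume r)
  have h2 := hw.comp_measurePreserving (measurePreserving_add_right volume h)
  exact memLp_one_iff_integrable.1
    ((ContinuousLinearMap.id ℝ (StrongDual ℝ E)).memLp_of_bilin 1 h1 h2)

/-- Integrability over a rectangle of a pairing with a translate by the second variable. -/
theorem integrable_prod_translate_pairing {g : ℝ → StrongDual ℝ E} {w : ℝ → E}
    (hgm : StronglyMeasurable g) (hwm : StronglyMeasurable w)
    (hg : MemLp g 2 volume) (hw : MemLp w 2 volume) (A B : Set ℝ) (hB : volume B ≠ ⊤) :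
    Integrable (fun p : ℝ × ℝ => g (p.1 + p.2) (w p.1))
      ((volume.restrict A).prod (volume.restrict B)) := by
  have : IsFiniteMeasure (volume.restrict B) := ⟨by simpa using hB.lt_top⟩
  have hm : StronglyMeasurable (fun p : ℝ × ℝ => g (p.1 + p.2) (w p.1)) :=
    ((ContinuousLinearMap.id ℝ (StrongDual ℝ E)).continuous₂.comp_stronglyMeasurable
      ((hgm.comp_measurable (measurable_fst.add measurable_snd)).prodMk
        (hwm.comp_measurable measurable_fst)) :)
  rw [integrable_prod_iff' hm.aestronglyMeasurable]
  have hint : ∀ r, Integrable (fun t => g (t + r) (w t)) := fun r => by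
    simpa using integrable_translate_pairing hg hw r 0
  have hg2 : Integrable (fun t => ‖g t‖ ^ 2) := hg.integrable_norm_pow two_ne_zero
  have hw2 : Integrable (fun t => ‖w t‖ ^ 2) := hw.integrable_norm_pow two_ne_zero
  refine ⟨.of_forall fun r => (hint r).restrict, ?_⟩
  -- By `xy ≤ x² + y²` and translation invariance, the inner integrals are bounded uniformly in `r`;
  -- a constant is integrable over `B`, which has finite measure.
  refine Integrable.of_bound (C := (∫ t, ‖g t‖ ^ 2) + ∫ t, ‖w t‖ ^ 2) ?_ (.of_forall fun r => ?_)
  · exact hm.norm.integral_prod_left'.aestronglyMeasurable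
  · rw [Real.norm_of_nonneg (integral_nonneg fun t => norm_nonneg _)]
    have hgr : Integrable (fun t => ‖g (t + r)‖ ^ 2) := hg2.comp_add_right r
    calc ∫ t in A, ‖g (t + r) (w t)‖ ≤ ∫ t, ‖g (t + r) (w t)‖ :=
          setIntegral_le_integral (hint r).norm (.of_forall fun t => norm_nonneg _)
      _ ≤ ∫ t, (‖g (t + r)‖ ^ 2 + ‖w t‖ ^ 2) := by
          refine integral_mono (hint r).norm (hgr.add hw2) fun t => ?_
          have := (g (t + r)).le_opNorm (w t)
          simp only
          nlinarith [sq_nonneg (‖g (t + r)‖ - ‖w t‖), sq_nonneg (‖g (t + r)‖),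
            sq_nonneg (‖w t‖)]
      _ = _ := by
          rw [integral_add hgr hw2, integral_add_right_eq_self (fun t => ‖g t‖ ^ 2) r]

end Translation

/-! ### The energy inequality in the Gelfand triple. -/

namespace Setting

variable {V H : Type*} [NormedAddCommGroup V] [InnerProductSpace ℝ V] [CompleteSpace V]
  [NormedAddCommGroup H] [InnerProductSpace ℝ H] [CompleteSpace H] (S : Setting V H)

/-- The integrated difference-quotient form of `d/dt ‖W‖² = 2 ⟨W', W⟩`. -/
theorem integral_sq_norm_sub_eq {T h : ℝ} (hh : 0 < h) {w : ℝ → V}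
    {g : ℝ → StrongDual ℝ V} {W : ℝ → H} (hgm : StronglyMeasurable g)
    (hwm : StronglyMeasurable w) (hg : MemLp g 2 volume) (hw : MemLp w 2 volume)
    (hW : Continuous W) (hwW : ∀ᵐ t, t ∈ Ioo 0 T → W t = S.ι (w t))
    (hd : HasWeakTimeDeriv T (fun t => S.toDualV (W t)) g) :
    ∫ t in Ioo 0 (T - h), (‖W (t + h)‖ ^ 2 - ‖W t‖ ^ 2) =
      ∫ r in Ioo 0 h, ∫ t in Ioo 0 (T - h), g (t + r) (w (t + h) + w t) := by
  have hgI : Integrable g (timeMeasure T) :=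
    (hg.restrict (Ioo 0 T)).integrable one_le_two
  have hwm' : StronglyMeasurable (fun t => w (t + h) + w t) :=
    (hwm.comp_measurable (measurable_id.add_const h)).add hwm
  have hw' : MemLp (fun t => w (t + h) + w t) 2 volume :=
    (hw.comp_measurePreserving (measurePreserving_add_right volume h)).add hw
  have hF := integrable_prod_translate_pairing hgm hwm' hg hw' (Ioo 0 (T - h)) (Ioo 0 h)
    (by simp)
  rw [← integral_integral_swap (f := fun t r => g (t + r) (w (t + h) + w t)) hF]
  refine setIntegral_congr_ae measurableSet_Ioo ?_
  have hsh := (measurePreserving_add_right volume h).quasiMeasurePreserving.ae hwW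
  filter_upwards [hwW, hsh] with t h1 h2 ht
  have e1 := h1 ⟨ht.1, by linarith [ht.2]⟩
  have e2 := h2 ⟨by linarith [ht.1], by linarith [ht.2]⟩
  have hftc := hd.sub_eq_integral (S.toDualV.continuous.comp hW).continuousOn hgI ht.1
    (show t < t + h by linarith) (by linarith [ht.2])
  have hii : IntervalIntegrable g volume t (t + h) :=
    ((hg.locallyIntegrable one_le_two).integrableOn_isCompact isCompact_uIcc).intervalIntegrable
  -- Factor the difference of squares: the difference factor is an integral of `g` in `V'`, while
  -- the sum factor comes from `V`, so their product is a duality pairing.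
  calc ‖W (t + h)‖ ^ 2 - ‖W t‖ ^ 2 = ⟪W (t + h) - W t, W (t + h) + W t⟫ := by
        rw [inner_sub_left, inner_add_right, inner_add_right, real_inner_self_eq_norm_sq,
          real_inner_self_eq_norm_sq, real_inner_comm (W t)]
        ring
    _ = (S.toDualV (W (t + h)) - S.toDualV (W t)) (w (t + h) + w t) := by
        rw [← map_sub, toDualV_apply, map_add, ← e1, ← e2]
    _ = ∫ r in t..t + h, g r (w (t + h) + w t) := by
        rw [hftc, ContinuousLinearMap.intervalIntegral_apply hii]
    _ = ∫ r in Ioo 0 h, g (t + r) (w (t + h) + w t) := by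
        rw [← integral_Ioc_eq_integral_Ioo, ← intervalIntegral.integral_of_le hh.le,
          intervalIntegral.integral_comp_add_left (fun r => g r (w (t + h) + w t)), add_zero]

/-- Divide `integral_sq_norm_sub_eq` by a small `h`. The left side telescopes to averages of `‖W‖²`
over `(T - h, T)` and `(0, h)`: the first is dropped by its sign, the second is close to `‖W 0‖²`.
The right side is close to `2 ∫ ⟨g, w⟩` by continuity of translations. -/
theorem neg_sq_norm_le_of_continuous {T : ℝ} (hT : 0 < T) {w : ℝ → V}
    {g : ℝ → StrongDual ℝ V} {W : ℝ → H} (hgm : StronglyMeasurable g)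
    (hwm : StronglyMeasurable w) (hg : MemLp g 2 volume) (hw : MemLp w 2 volume)
    (hW : Continuous W) (hwW : ∀ᵐ t, t ∈ Ioo 0 T → W t = S.ι (w t))
    (hd : HasWeakTimeDeriv T (fun t => S.toDualV (W t)) g) :
    -‖W 0‖ ^ 2 ≤ 2 * ∫ t in Ioo 0 T, g t (w t) := by
  set K := ∫ t in Ioo 0 T, g t (w t)
  have hpair : ∀ r h, Integrable (fun t => g (t + r) (w (t + h))) :=
    integrable_translate_pairing hg hw
  have hpair0 : Integrable (fun t => g t (w t)) := by simpa using hpair 0 0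
  refine le_of_forall_pos_le_add fun ε hε => ?_
  have hδ : 0 < ε / 8 := by positivity
  -- The lower bound below loses `δ` and the upper bound `4 δ`, and `5 δ ≤ ε`.
  set δ := ε / 8 with hδ_def
  have hN : Continuous fun t => ‖W t‖ ^ 2 := hW.norm.pow 2
  obtain ⟨η₁, hη₁, H1⟩ := Metric.eventually_nhds_iff.1
    (hN.continuousAt.eventually_lt_const (show ‖W 0‖ ^ 2 < ‖W 0‖ ^ 2 + δ by linarith))
  obtain ⟨η₂, hη₂, H2⟩ := Metric.eventually_nhds_iff.1
    ((tendsto_integral_abs_translate_pairing hg hw).eventually_lt_const hδ)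
  have hprim : Continuous fun x => ∫ t in (0 : ℝ)..x, g t (w t) :=
    intervalIntegral.continuous_primitive (fun a b => hpair0.intervalIntegrable) 0
  have hK : ∫ t in (0 : ℝ)..T, g t (w t) = K := by
    rw [intervalIntegral.integral_of_le hT.le, integral_Ioc_eq_integral_Ioo]
  obtain ⟨η₃, hη₃, H3⟩ := Metric.eventually_nhds_iff.1
    (hprim.continuousAt.eventually_lt_const
      (show ∫ t in (0 : ℝ)..T, g t (w t) < K + δ by linarith))
  obtain ⟨h, hh, hlt⟩ := exists_between
    (show (0 : ℝ) < min (min η₁ η₂) (min η₃ T) by positivity)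
  obtain ⟨⟨hh1, hh2⟩, hh3, hhT⟩ : (h < η₁ ∧ h < η₂) ∧ h < η₃ ∧ h < T := by
    simpa only [lt_min_iff] using hlt
  have hlow : -(h * (‖W 0‖ ^ 2 + δ)) ≤
      ∫ t in Ioo 0 (T - h), (‖W (t + h)‖ ^ 2 - ‖W t‖ ^ 2) := by
    have hi : ∀ a b, IntervalIntegrable (fun t => ‖W t‖ ^ 2) volume a b :=
      fun a b => hN.intervalIntegrable a b
    have hi' : IntervalIntegrable (fun t => ‖W (t + h)‖ ^ 2) volume 0 (T - h) :=
      (hN.comp (continuous_add_const h)).intervalIntegrable _ _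
    rw [← integral_Ioc_eq_integral_Ioo, ← intervalIntegral.integral_of_le (by linarith),
      intervalIntegral.integral_sub hi' (hi _ _),
      intervalIntegral.integral_comp_add_right (fun t => ‖W t‖ ^ 2), zero_add, sub_add_cancel]
    have a1 := intervalIntegral.integral_add_adjacent_intervals (hi 0 h) (hi h T)
    have a2 := intervalIntegral.integral_add_adjacent_intervals (hi 0 (T - h)) (hi (T - h) T)
    have a3 : 0 ≤ ∫ t in (T - h)..T, ‖W t‖ ^ 2 :=
      intervalIntegral.integral_nonneg (by linarith) fun t _ => by positivity
    have a4 : ∫ t in (0 : ℝ)..h, ‖W t‖ ^ 2 ≤ ∫ t in (0 : ℝ)..h, (‖W 0‖ ^ 2 + δ) := by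
      refine intervalIntegral.integral_mono_on hh.le (hi _ _) (by simp) fun t ht => ?_
      refine (H1 ?_).le
      rw [Real.dist_eq, sub_zero, abs_of_nonneg ht.1]
      exact ht.2.trans_lt hh1
    rw [intervalIntegral.integral_const, sub_zero, smul_eq_mul] at a4
    linarith
  -- Each of the two pairings is at most `K + 2 δ`: one `δ` pays for the translation, the other for
  -- shortening the interval to `(0, T - h)`.
  have hinner : ∀ r ∈ Ioo 0 h,
      ∫ t in Ioo 0 (T - h), g (t + r) (w (t + h) + w t) ≤ 2 * K + 4 * δ := by
    intro r hr
    have hdiff : ∀ q, 0 ≤ q → q ≤ h →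
        ∫ t in Ioo 0 (T - h), (g (t + r) (w (t + q)) - g t (w t)) ≤ δ := by
      intro q hq hqh
      have hI : Integrable (fun t => g (t + r) (w (t + q)) - g t (w t)) :=
        (hpair r q).sub hpair0
      refine (integral_mono hI.restrict hI.abs.restrict fun t => le_abs_self _).trans
        ((setIntegral_le_integral hI.abs (.of_forall fun t => abs_nonneg _)).trans ?_)
      refine (H2 (y := (r, q)) ?_).le
      rw [Prod.dist_eq, max_lt_iff]
      simp only [Prod.fst_zero, Prod.snd_zero, Real.dist_eq, sub_zero]
      rw [abs_of_pos hr.1, abs_of_nonneg hq]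
      exact ⟨hr.2.trans hh2, hqh.trans_lt hh2⟩
    have b1 := hdiff h hh.le le_rfl
    have b2 := hdiff 0 le_rfl hh.le
    have b3 : ∫ t in Ioo 0 (T - h), g t (w t) ≤ K + δ := by
      rw [← integral_Ioc_eq_integral_Ioo, ← intervalIntegral.integral_of_le (by linarith)]
      refine (H3 ?_).le
      rw [Real.dist_eq, sub_sub_cancel_left, abs_neg, abs_of_pos hh]
      exact hh3
    rw [integral_sub (hpair _ _).restrict hpair0.restrict] at b1 b2
    simp only [add_zero] at b2
    have hp0 : Integrable (fun t => g (t + r) (w t)) := by simpa using hpair r 0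
    simp only [map_add]
    rw [integral_add (hpair _ _).restrict hp0.restrict]
    linarith
  have hup : ∫ r in Ioo 0 h, ∫ t in Ioo 0 (T - h), g (t + r) (w (t + h) + w t) ≤
      h * (2 * K + 4 * δ) := by
    have hwm' : StronglyMeasurable (fun t => w (t + h) + w t) :=
      (hwm.comp_measurable (measurable_id.add_const h)).add hwm
    have hw' : MemLp (fun t => w (t + h) + w t) 2 volume :=
      (hw.comp_measurePreserving (measurePreserving_add_right volume h)).add hw
    have hF := integrable_prod_translate_pairing hgm hwm' hg hw' (Ioo 0 (T - h)) (Ioo 0 h)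
      (by simp)
    have := setIntegral_mono_on hF.integral_prod_right
      (integrableOn_const (μ := volume) (s := Ioo 0 h) (C := 2 * K + 4 * δ) (by simp))
      measurableSet_Ioo hinner
    rw [setIntegral_const, smul_eq_mul] at this
    simpa [Measure.real, hh.le] using this
  rw [← S.integral_sq_norm_sub_eq hh hgm hwm hg hw hW hwW hd] at hup
  have := hlow.trans hup
  rw [← mul_neg] at this
  have := le_of_mul_le_mul_left this hh
  linarith

/-- The energy inequality: a function `w ∈ L²(0,T;V)` with weak derivative `g ∈ L²(0,T;V')` and
continuous representative `W` satisfies `-‖W(0)‖² ≤ 2 ∫ ⟨g, w⟩`. -/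
theorem neg_sq_norm_le_integral {T : ℝ} (hT : 0 < T) {w : ℝ → V} {g : ℝ → StrongDual ℝ V}
    {W : ℝ → H} (hg : MemLp g 2 (timeMeasure T)) (hw : MemLp w 2 (timeMeasure T))
    (hW : ContinuousOn W (Icc 0 T)) (hwW : W =ᵐ[timeMeasure T] fun t => S.ι (w t))
    (hd : HasWeakTimeDeriv T (fun t => S.toDualV (S.ι (w t))) g) :
    -‖W 0‖ ^ 2 ≤ 2 * ∫ t, g t (w t) ∂(timeMeasure T) := by
  -- Translations and Fubini require strongly measurable functions on all of `ℝ`, so a measurable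
  -- version is extended by zero outside `(0, T)`.
  have exists_rep : ∀ {E : Type _} [NormedAddCommGroup E] (f : ℝ → E), MemLp f 2 (timeMeasure T) →
      ∃ f₁ : ℝ → E, StronglyMeasurable f₁ ∧ MemLp f₁ 2 volume ∧ f =ᵐ[timeMeasure T] f₁ := by
    intro E _ f hf
    have hae : f =ᵐ[timeMeasure T] (Ioo 0 T).indicator (hf.1.mk f) :=
      hf.1.ae_eq_mk.trans (indicator_ae_eq_restrict measurableSet_Ioo).symm
    refine ⟨(Ioo 0 T).indicator (hf.1.mk f),
      hf.1.stronglyMeasurable_mk.indicator measurableSet_Ioo, ?_, hae⟩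
    exact (memLp_indicator_iff_restrict measurableSet_Ioo).2 (hf.ae_eq hf.1.ae_eq_mk)
  obtain ⟨g₁, hg1, hg2, hg3⟩ := exists_rep g hg
  obtain ⟨w₁, hw1, hw2, hw3⟩ := exists_rep w hw
  -- Unlike `g` and `w`, the continuous representative is extended by its endpoint values, which
  -- preserves continuity.
  let W₁ : ℝ → H := fun t => W (projIcc 0 T hT.le t)
  have hW₁ : Continuous W₁ := hW.domRestrict.comp continuous_projIcc
  have hWW : ∀ t ∈ Icc 0 T, W₁ t = W t := fun t ht => by
    simp only [W₁, projIcc_of_mem hT.le ht]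
  have hmem : ∀ᵐ t ∂(timeMeasure T), t ∈ Ioo 0 T := ae_restrict_mem measurableSet_Ioo
  have hW₁w : ∀ᵐ t ∂(timeMeasure T), W₁ t = S.ι (w₁ t) := by
    filter_upwards [hmem, hwW, hw3] with t h1 h2 h3
    rw [hWW t (Ioo_subset_Icc_self h1), h2, h3]
  have hd₁ : HasWeakTimeDeriv T (fun t => S.toDualV (W₁ t)) g₁ := by
    refine hd.congr ?_ hg3
    filter_upwards [hW₁w, hw3] with t h1 h2
    rw [h1, h2]
  have := S.neg_sq_norm_le_of_continuous hT hg1 hw1 hg2 hw2 hW₁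
    ((ae_restrict_iff' measurableSet_Ioo).1 hW₁w) hd₁
  rw [hWW 0 (left_mem_Icc.2 hT.le)] at this
  refine this.trans_eq ?_
  congr 1
  refine integral_congr_ae ?_
  filter_upwards [hg3, hw3] with t h1 h2
  rw [h1, h2]

/-! ### The energy norm, its dual norm and the continuity constant. -/

theorem ah_inV (v w : V) : S.ah (S.inV v) (S.inV w) = S.a v w :=
  S.ah_eq v w _ _ rfl rfl

theorem a_self_nonneg (v : V) : 0 ≤ S.a v v := by
  obtain ⟨c, hc, h⟩ := S.a_coercive
  exact le_trans (by positivity) (h v)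

theorem energy_inV (v : V) : S.energy (S.inV v) = √(S.a v v) := by
  rw [S.energy_eq v _ rfl, ah_inV]

theorem energy_inV_sq (v : V) : S.energy (S.inV v) ^ 2 = S.a v v := by
  rw [energy_inV, Real.sq_sqrt (S.a_self_nonneg v)]

/-- Coercivity, after a square root. This is what makes the supremum in `dualEnergy` finite and the
set of constants in `gamma` nonempty, so that neither takes a junk value. -/
theorem exists_mul_norm_le_energy : ∃ c > 0, ∀ v : V, c * ‖v‖ ≤ S.energy (S.inV v) := by
  obtain ⟨c, hc, h⟩ := S.a_coercive
  refine ⟨√c, Real.sqrt_pos.2 hc, fun v => ?_⟩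
  rw [energy_inV]
  refine Real.le_sqrt_of_sq_le ?_
  rw [mul_pow, Real.sq_sqrt hc.le, sq, ← mul_assoc]
  exact h v

theorem continuous_energy_inV : Continuous fun v => S.energy (S.inV v) := by
  simp only [energy_inV]
  exact (S.a.continuous₂.comp (continuous_id.prodMk continuous_id)).sqrt

theorem energy_inV_le (v : V) : S.energy (S.inV v) ≤ √‖S.a‖ * ‖v‖ := by
  rw [energy_inV]
  refine Real.sqrt_le_iff.2 ⟨by positivity, ?_⟩
  rw [mul_pow, Real.sq_sqrt (norm_nonneg S.a), sq, ← mul_assoc]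
  exact (le_abs_self _).trans (S.a.le_opNorm₂ v v)

/-- The setting assumes no continuity of the energy norm on `Ṽ`; it is automatic, because a seminorm
is convex and a finite convex function on a finite-dimensional space is continuous. -/
theorem continuous_energy_inVt : Continuous fun x => S.energy (S.inVt x) := by
  have h : ConvexOn ℝ univ fun x => (S.energy.comp S.inVt) x := Seminorm.convexOn _
  exact continuousOn_univ.1 (h.continuousOn isOpen_univ)

/-- The energy norm of `v - ṽ` depends continuously on `(v, ṽ) ∈ V × Ṽ`. -/
theorem continuous_energy_sub :
    Continuous fun p : V × S.Vt => S.energy (S.inV p.1 - S.inVt p.2) := by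
  let q : Seminorm ℝ (V × S.Vt) :=
    S.energy.comp (S.inV.comp (LinearMap.fst ℝ V S.Vt) - S.inVt.comp (LinearMap.snd ℝ V S.Vt))
  let q' : Seminorm ℝ (V × S.Vt) :=
    S.energy.comp (S.inV.comp (LinearMap.fst ℝ V S.Vt)) +
      S.energy.comp (S.inVt.comp (LinearMap.snd ℝ V S.Vt))
  have hq' : Continuous q' := (S.continuous_energy_inV.comp continuous_fst).add
    (S.continuous_energy_inVt.comp continuous_snd)
  exact Seminorm.continuous_of_le (p := q) hq' fun p => map_sub_le_add S.energy _ _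

/-- The infimum `gamma` is itself an admissible constant: divide by the product of the energies when
it is positive; when it vanishes, any admissible constant already forces `a v w = 0`. -/
theorem abs_a_le (v w : V) :
    |S.a v w| ≤ S.gamma * S.energy (S.inV v) * S.energy (S.inV w) := by
  obtain ⟨c, hc, h⟩ := S.exists_mul_norm_le_energy
  have hne : {γ : ℝ | 0 ≤ γ ∧ ∀ v w : V, |S.ah (S.inV v) (S.inV w)| ≤
      γ * S.energy (S.inV v) * S.energy (S.inV w)}.Nonempty := by
    refine ⟨‖S.a‖ / c ^ 2, by positivity, fun v w => ?_⟩
    rw [ah_inV]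
    calc |S.a v w| ≤ ‖S.a‖ * ‖v‖ * ‖w‖ := S.a.le_opNorm₂ v w
      _ = ‖S.a‖ / c ^ 2 * (c * ‖v‖) * (c * ‖w‖) := by field_simp
      _ ≤ _ := by gcongr <;> exact h _
  rcases (mul_nonneg (apply_nonneg S.energy (S.inV v))
    (apply_nonneg S.energy (S.inV w))).eq_or_lt with h0 | h0
  · obtain ⟨γ, -, hγ⟩ := hne
    have := hγ v w
    rw [mul_assoc, ← h0, mul_zero, ah_inV] at this
    rwa [mul_assoc, ← h0, mul_zero]
  · rw [mul_assoc, ← div_le_iff₀ h0]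
    refine le_csInf hne fun γ hγ => ?_
    rw [div_le_iff₀ h0, ← mul_assoc, ← ah_inV]
    exact hγ.2 v w

theorem exists_abs_div_energy_le :
    ∃ M : ℝ, 0 ≤ M ∧ ∀ (φ : StrongDual ℝ V) (v : V), |φ v| / S.energy (S.inV v) ≤ M * ‖φ‖ := by
  obtain ⟨c, hc, h⟩ := S.exists_mul_norm_le_energy
  refine ⟨c⁻¹, by positivity, fun φ v => ?_⟩
  refine div_le_of_le_mul₀ (apply_nonneg _ _) (by positivity) ?_
  calc |φ v| ≤ ‖φ‖ * ‖v‖ := φ.le_opNorm v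
    _ = c⁻¹ * ‖φ‖ * (c * ‖v‖) := by field_simp
    _ ≤ _ := by gcongr; exact h v

theorem bddAbove_dualEnergy (φ : StrongDual ℝ V) :
    BddAbove (range fun v : V => |φ v| / S.energy (S.inV v)) := by
  obtain ⟨M, -, hM⟩ := S.exists_abs_div_energy_le
  exact ⟨M * ‖φ‖, forall_mem_range.2 (hM φ)⟩

theorem dualEnergy_nonneg (φ : StrongDual ℝ V) : 0 ≤ S.dualEnergy φ :=
  Real.iSup_nonneg fun _ => div_nonneg (abs_nonneg _) (apply_nonneg _ _)

theorem abs_apply_le_dualEnergy (φ : StrongDual ℝ V) (v : V) :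
    |φ v| ≤ S.dualEnergy φ * S.energy (S.inV v) := by
  obtain ⟨c, hc, h⟩ := S.exists_mul_norm_le_energy
  rcases eq_or_ne v 0 with rfl | hv
  · simp
  · have : 0 < S.energy (S.inV v) := lt_of_lt_of_le (by positivity) (h v)
    rw [← div_le_iff₀ this]
    exact le_ciSup (S.bddAbove_dualEnergy φ) v

/-- A supremum of functions of `φ` with a common Lipschitz constant `M` is Lipschitz. This supplies
the measurability in `memLp_dualEnergy`. -/
theorem continuous_dualEnergy : Continuous S.dualEnergy := by
  obtain ⟨M, hM0, hM⟩ := S.exists_abs_div_energy_le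
  refine (LipschitzWith.of_le_add_mul ⟨M, hM0⟩ fun φ ψ => ?_).continuous
  refine ciSup_le fun v => ?_
  have h1 : |φ v| ≤ |ψ v| + |(φ - ψ) v| := by
    have := abs_add_le (ψ v) ((φ - ψ) v)
    simpa using this
  rw [dist_eq_norm]
  calc |φ v| / S.energy (S.inV v)
      ≤ (|ψ v| + |(φ - ψ) v|) / S.energy (S.inV v) := by
        gcongr
    _ = |ψ v| / S.energy (S.inV v) + |(φ - ψ) v| / S.energy (S.inV v) := add_div _ _ _
    _ ≤ _ := add_le_add (le_ciSup (S.bddAbove_dualEnergy ψ) v) (hM _ v)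

theorem memLp_dualEnergy {α : Type*} {m : MeasurableSpace α} {μ : Measure α}
    {g : α → StrongDual ℝ V} (hg : MemLp g 2 μ) : MemLp (fun t => S.dualEnergy (g t)) 2 μ := by
  obtain ⟨M, -, hM⟩ := S.exists_abs_div_energy_le
  refine hg.of_le_mul (c := M) (S.continuous_dualEnergy.comp_aestronglyMeasurable hg.1)
    (.of_forall fun t => ?_)
  rw [Real.norm_of_nonneg (S.dualEnergy_nonneg _)]
  exact ciSup_le (hM _)

theorem memLp_energy_inV {α : Type*} {m : MeasurableSpace α} {μ : Measure α}
    {w : α → V} (hw : MemLp w 2 μ) : MemLp (fun t => S.energy (S.inV (w t))) 2 μ := by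
  refine hw.of_le_mul (c := √‖S.a‖) (S.continuous_energy_inV.comp_aestronglyMeasurable hw.1)
    (.of_forall fun t => ?_)
  rw [Real.norm_of_nonneg (apply_nonneg _ _)]
  exact S.energy_inV_le _

/-! ### Regularity of `ũᶜ` and of the elliptic reconstruction. -/

/-- On `V ∩ Ṽ` the inclusion into `H` has a continuous left inverse. -/
theorem exists_clm_leftInverse : ∃ L : S.Vt →L[ℝ] V, ∀ (v : V) (x : S.Vt), (x : H) = S.ι v →
    L x = v := by
  -- `Q` is `V ∩ Ṽ` seen inside `V`. An algebraic left inverse of `Q → Ṽ` is continuous because `Ṽ`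
  -- is finite-dimensional; its values off the image of `Q` are irrelevant.
  let Q : Submodule ℝ V := S.Vt.comap S.ι.toLinearMap
  let j : Q →ₗ[ℝ] S.Vt := (S.ι.toLinearMap.comp Q.subtype).codRestrict S.Vt fun x => x.2
  have hj : LinearMap.ker j = ⊥ := by
    refine LinearMap.ker_eq_bot.2 fun x y hxy => ?_
    exact Subtype.ext (S.ι_injective (congrArg (Subtype.val) hxy))
  obtain ⟨k, hk⟩ := j.exists_leftInverse_of_injective hj
  refine ⟨LinearMap.toContinuousLinearMap (Q.subtype.comp k), fun v x hx => ?_⟩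
  have hv : v ∈ Q := by
    change S.ι v ∈ S.Vt
    rw [← hx]; exact x.2
  have hxj : x = j ⟨v, hv⟩ := Subtype.ext hx
  have := LinearMap.congr_fun hk ⟨v, hv⟩
  rw [hxj]
  simpa using congrArg Subtype.val this

/-- The reconstruction is affine, with `f` entering only the constant part, and `A_h` is continuous
as a linear map on a finite-dimensional space. Square-integrability of `R_ell(ũ)` follows. -/
theorem exists_ellRec_eq (f : H) : ∃ (L : S.Vt →L[ℝ] V) (r : V), ∀ x, S.ellRec f x = L x + r := by
  let A : S.Vt →ₗ[ℝ] S.Vt :=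
    { toFun := S.Ah
      map_add' := fun x y => ext_inner_right ℝ fun z => by
        rw [inner_add_left]
        simp only [Submodule.coe_inner, inner_Ah, map_add, LinearMap.add_apply]
      map_smul' := fun c x => ext_inner_right ℝ fun z => by
        rw [RingHom.id_apply, inner_smul_left]
        simp only [Submodule.coe_inner, inner_Ah, map_smul, LinearMap.smul_apply]
        simp }
  refine ⟨(S.a_coercive.continuousLinearEquivOfBilin.symm : V →L[ℝ] V) ∘L S.ι.adjoint ∘L
    S.Vt.subtypeL ∘L LinearMap.toContinuousLinearMap A,
    S.a_coercive.continuousLinearEquivOfBilin.symm (S.ι.adjoint (f - S.Vt.starProjection f)),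
    fun x => ?_⟩
  change S.a_coercive.continuousLinearEquivOfBilin.symm _ =
    S.a_coercive.continuousLinearEquivOfBilin.symm (S.ι.adjoint (S.Ah x : H)) + _
  rw [← map_add, ← map_add]
  congr 2
  abel

theorem memLp_ellRec {T : ℝ} (f : H) {x : ℝ → S.Vt} (hx : MemLp x 2 (timeMeasure T)) :
    MemLp (fun t => S.ellRec f (x t)) 2 (timeMeasure T) := by
  have : IsFiniteMeasure (timeMeasure T) := ⟨by simp [timeMeasure]⟩
  obtain ⟨L, r, h⟩ := S.exists_ellRec_eq f
  simp only [h]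
  exact (L.comp_memLp' hx).add (memLp_const r)

/-- The Galerkin equation in strong form: `∂ₜũ = Π̃ f - A_h(ũ)`. -/
theorem eq_of_galerkin {f : H} {x y : S.Vt}
    (h : ∀ v : S.Vt, ⟪(y : H), (v : H)⟫ + S.ah (S.inVt x) (S.inVt v) = ⟪f, (v : H)⟫) :
    (y : H) = S.Vt.starProjection f - S.Ah x := by
  have hP : S.Vt.starProjection f = (S.Vt.orthogonalProjectionOnto f : H) := rfl
  have : y = S.Vt.orthogonalProjectionOnto f - S.Ah x := by
    refine ext_inner_right ℝ fun z => ?_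
    rw [inner_sub_left, eq_sub_iff_add_eq]
    have h1 := h z
    rw [← inner_Ah] at h1
    simp only [Submodule.coe_inner]
    rw [h1, ← hP, Submodule.inner_starProjection_left_eq_right,
      Submodule.starProjection_eq_self_iff.2 z.2]
  rw [this, hP]; rfl

/-- The pointwise estimate behind the error bound. -/
theorem two_mul_apply_add_sq_energy_le {φ ψ : StrongDual ℝ V} {ρ e : V}
    (h : φ (ρ + e) + S.a ρ (ρ + e) = ψ (ρ + e)) :
    2 * φ (ρ + e) + S.energy (S.inV ρ) ^ 2 ≤
      3 * S.dualEnergy ψ ^ 2 + (2 * S.gamma ^ 2 + 1) * S.energy (S.inV e) ^ 2 := by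
  have h1 := (abs_le.1 (S.abs_a_le ρ e)).1
  have h2 := (abs_le.1 (S.abs_apply_le_dualEnergy ψ ρ)).2
  have h3 := (abs_le.1 (S.abs_apply_le_dualEnergy ψ e)).2
  have h4 := S.energy_inV_sq ρ
  have h5 : S.a ρ (ρ + e) = S.a ρ ρ + S.a ρ e := map_add _ _ _
  have h6 : ψ (ρ + e) = ψ ρ + ψ e := map_add _ _ _
  set R := S.energy (S.inV ρ)
  set E := S.energy (S.inV e)
  set D := S.dualEnergy ψ
  set γ := S.gamma
  -- Young's inequality three times: `2γRE ≤ R²/2 + 2γ²E²`, `2DR ≤ R²/2 + 2D²` and `2DE ≤ D² + E²`.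
  -- The two halves of `R²` are absorbed by `a(ρ, ρ)`, and the rest gives the constants `3` and `2γ²
  -- + 1`.
  nlinarith [sq_nonneg (R - 2 * γ * E), sq_nonneg (R - 2 * D), sq_nonneg (D - E)]

end Setting

theorem eLpNorm_two_eq_ofReal_sqrt {α : Type*} {m : MeasurableSpace α} {μ : Measure α}
    {f : α → ℝ} (hf : MemLp f 2 μ) : eLpNorm f 2 μ = ENNReal.ofReal √(∫ t, f t ^ 2 ∂μ) := by
  rw [hf.eLpNorm_eq_integral_rpow_norm two_ne_zero ENNReal.ofNat_ne_top]
  simp [Real.sqrt_eq_rpow]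

theorem integral_add_le_of_ae_le {α : Type*} {m : MeasurableSpace α} {μ : Measure α}
    {p q r s : α → ℝ} {a b c : ℝ} (hp : Integrable p μ) (hq : Integrable q μ)
    (hr : Integrable r μ) (hs : Integrable s μ)
    (h : ∀ᵐ t ∂μ, a * p t + q t ≤ b * r t + c * s t) :
    a * ∫ t, p t ∂μ + ∫ t, q t ∂μ ≤ b * ∫ t, r t ∂μ + c * ∫ t, s t ∂μ := by
  have := integral_mono_ae ((hp.const_mul a).add hq) ((hr.const_mul b).add (hs.const_mul c)) h
  simp only [Pi.add_apply] at this
  rwa [integral_add (hp.const_mul a) hq, integral_add (hr.const_mul b) (hs.const_mul c),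
    integral_const_mul, integral_const_mul, integral_const_mul] at this

/-! ### The error equation and the estimate for `ρ`. -/

namespace Setting

variable {V H : Type*} [NormedAddCommGroup V] [InnerProductSpace ℝ V] [CompleteSpace V]
  [NormedAddCommGroup H] [InnerProductSpace ℝ H] [CompleteSpace H] (S : Setting V H)

/-- The conforming part of the approximation is square-integrable with values in `V`. -/
theorem memLp_of_coe_eq_add {T : ℝ} {ut ud : ℝ → S.Vt} {uc : ℝ → V}
    (hdec : ∀ᵐ t ∂(timeMeasure T), (ut t : H) = S.ι (uc t) + ud t)
    (hut : MemLp ut 2 (timeMeasure T)) (hud : MemLp ud 2 (timeMeasure T)) :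
    MemLp uc 2 (timeMeasure T) := by
  obtain ⟨L, hL⟩ := S.exists_clm_leftInverse
  refine (L.comp_memLp' (hut.sub hud)).ae_eq ?_
  filter_upwards [hdec] with t ht
  exact hL _ _ (by simp [ht])

/-- The weak derivative of the conforming error `eᶜ = u - ũ + ũᵈ`. -/
theorem hasWeakTimeDeriv_conformingError {T : ℝ} {u uc : ℝ → V} {u' ud' : ℝ → StrongDual ℝ V}
    {ut ut' ud : ℝ → S.Vt} (hdec : ∀ᵐ t ∂(timeMeasure T), (ut t : H) = S.ι (uc t) + ud t)
    (hu : Integrable u (timeMeasure T)) (hu' : Integrable u' (timeMeasure T))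
    (huw : HasWeakTimeDeriv T (fun t => S.toDualV (S.ι (u t))) u')
    (hut : Integrable ut (timeMeasure T)) (hut' : Integrable ut' (timeMeasure T))
    (hutw : HasWeakTimeDeriv T ut ut')
    (hud : Integrable ud (timeMeasure T)) (hud' : Integrable ud' (timeMeasure T))
    (hudw : HasWeakTimeDeriv T (fun t => S.toDualV (ud t)) ud') :
    HasWeakTimeDeriv T (fun t => S.toDualV (S.ι (u t - uc t)))
      (fun t => u' t - (S.toDualV (ut' t) - ud' t)) := by
  let J : S.Vt →L[ℝ] StrongDual ℝ V := S.toDualV ∘L S.Vt.subtypeL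
  have hJt : HasWeakTimeDeriv T (fun t => (-J) (ut t)) (fun t => (-J) (ut' t)) :=
    hutw.clm_comp (-J) hut hut'
  have h1 := (-J).integrable_comp hut
  have h2 := (-J).integrable_comp hut'
  have h3 := (S.toDualV ∘L S.ι).integrable_comp hu
  have h4 := huw.add hJt h3 hu' h1 h2
  have h5 := h4.add hudw (h3.add h1) (hu'.add h2) (J.integrable_comp hud) hud'
  refine h5.congr ?_ (.of_forall fun t => ?_)
  · filter_upwards [hdec] with t ht
    change S.toDualV (S.ι (u t)) + -S.toDualV (ut t : H) + _ = _
    rw [ht, map_sub, map_sub, map_add]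
    abel
  · change u' t + -S.toDualV (ut' t : H) + ud' t =
      u' t - (S.toDualV (ut' t) - ud' t)
    abel

/-- The error equation `⟨∂ₜeᶜ, v⟩ + a(ρ, v) = ⟨∂ₜũᵈ, v⟩` at a fixed time. -/
theorem error_equation {f : H} {u : V} {φ ψ : StrongDual ℝ V} {x y : S.Vt}
    (hu : ∀ v : V, φ v + S.a u v = ⟪f, S.ι v⟫)
    (hx : ∀ v : S.Vt, ⟪(y : H), (v : H)⟫ + S.ah (S.inVt x) (S.inVt v) = ⟪f, (v : H)⟫) (v : V) :
    (φ - (S.toDualV y - ψ)) v + S.a (u - S.ellRec f x) v = ψ v := by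
  have h3 := S.eq_of_galerkin hx
  have h4 := (S.eq_ellRec_iff f x _).1 rfl v
  rw [ah_inV] at h4
  have h5 := hu v
  rw [_root_.sub_apply, _root_.sub_apply, toDualV_apply, h3, map_sub S.a, _root_.sub_apply, h4, inner_sub_left, inner_add_left, inner_sub_left]
  linarith

/-- The energy estimate for `ρ = u - R_ell(ũ)`:
`∫ |||ρ|||² ≤ ‖eᶜ(0)‖² + 3 ∫ |||∂ₜũᵈ|||² + (2 γ² + 1) ∫ |||R_ell(ũ) - ũᶜ|||²`. -/
theorem integral_sq_energy_sub_ellRec_le {T : ℝ} (hT : 0 < T) {f : H} {u₀ : V} {u : ℝ → V}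
    (hu : S.IsWeakSolution T f u₀ u) {ut : ℝ → S.Vt} (hut : S.IsGalerkinSolution T f ut)
    {uc : ℝ → V} {ud : ℝ → S.Vt}
    (hdec : ∀ᵐ t ∂(timeMeasure T), (ut t : H) = S.ι (uc t) + ud t)
    {uc₀ : V} (huc₀ : HasInitialValue T (fun t => S.ι (uc t)) (S.ι uc₀))
    (hud : MemLp ud 2 (timeMeasure T)) {ud' : ℝ → StrongDual ℝ V}
    (hud' : MemLp ud' 2 (timeMeasure T))
    (hderiv : HasWeakTimeDeriv T (fun t => S.toDualV (ud t)) ud') :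
    ∫ t, S.energy (S.inV (u t - S.ellRec f (ut t))) ^ 2 ∂(timeMeasure T) ≤
      ‖S.ι u₀ - S.ι uc₀‖ ^ 2 + 3 * ∫ t, S.dualEnergy (ud' t) ^ 2 ∂(timeMeasure T) +
        (2 * S.gamma ^ 2 + 1) *
          ∫ t, S.energy (S.inV (S.ellRec f (ut t) - uc t)) ^ 2 ∂(timeMeasure T) := by
  obtain ⟨hu2, ⟨U, hUc, hUu, hU0⟩, u', hu', huw, hueq⟩ := hu
  obtain ⟨hut2, ut', hut', hutw, huteq⟩ := hut
  obtain ⟨Uc, hUcc, hUcu, hUc0⟩ := huc₀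
  have : IsFiniteMeasure (timeMeasure T) := ⟨by simp [timeMeasure]⟩
  have huc2 := S.memLp_of_coe_eq_add hdec hut2 hud
  have hR := S.memLp_ellRec f hut2
  have hJ : MemLp (fun t => S.toDualV (ut' t : H)) 2 (timeMeasure T) :=
    S.toDualV.comp_memLp' (S.Vt.subtypeL.comp_memLp' hut')
  let R : ℝ → V := fun t => S.ellRec f (ut t)
  let g : ℝ → StrongDual ℝ V := fun t => u' t - (S.toDualV (ut' t) - ud' t)
  have hg : MemLp g 2 (timeMeasure T) := hu'.sub (hJ.sub hud')
  have hec : MemLp (fun t => u t - uc t) 2 (timeMeasure T) := hu2.sub huc2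
  have hw : HasWeakTimeDeriv T (fun t => S.toDualV (S.ι (u t - uc t))) g :=
    S.hasWeakTimeDeriv_conformingError hdec (hu2.integrable one_le_two)
      (hu'.integrable one_le_two) huw (hut2.integrable one_le_two) (hut'.integrable one_le_two)
      hutw (hud.integrable one_le_two) (hud'.integrable one_le_two) hderiv
  have key := S.neg_sq_norm_le_integral (W := fun t => U t - Uc t) hT hg hec (hUc.sub hUcc)
    (by filter_upwards [hUu, hUcu] with t h1 h2; rw [h1, h2, map_sub]) hw
  rw [hU0, hUc0] at key
  have hρ : Integrable (fun t => S.energy (S.inV (u t - R t)) ^ 2) (timeMeasure T) :=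
    (S.memLp_energy_inV (hu2.sub hR)).integrable_sq
  have hε : Integrable (fun t => S.energy (S.inV (R t - uc t)) ^ 2) (timeMeasure T) :=
    (S.memLp_energy_inV (hR.sub huc2)).integrable_sq
  have hD : Integrable (fun t => S.dualEnergy (ud' t) ^ 2) (timeMeasure T) :=
    (S.memLp_dualEnergy hud').integrable_sq
  have hpair : Integrable (fun t => g t (u t - uc t)) (timeMeasure T) :=
    memLp_one_iff_integrable.1
      ((ContinuousLinearMap.id ℝ (StrongDual ℝ V)).memLp_of_bilin 1 hg hec)
  have hpt : ∀ᵐ t ∂(timeMeasure T), 2 * g t (u t - uc t) + S.energy (S.inV (u t - R t)) ^ 2 ≤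
      3 * S.dualEnergy (ud' t) ^ 2 +
        (2 * S.gamma ^ 2 + 1) * S.energy (S.inV (R t - uc t)) ^ 2 := by
    filter_upwards [hueq, huteq] with t h1 h2
    -- With this choice `ρ + e` is `u - ũᶜ = eᶜ`, the test function.
    have h3 := S.two_mul_apply_add_sq_energy_le (e := R t - uc t)
      (S.error_equation (ψ := ud' t) h1 h2 _)
    rwa [sub_add_sub_cancel] at h3
  have := integral_add_le_of_ae_le hpair hρ hD hε hpt
  linarith

end Setting

/-- `√(x² + y² + z²) ≤ x + y + z` for nonnegative reals, with weights. -/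
theorem sqrt_add_mul_add_mul_le {x c y d z : ℝ} (hx : 0 ≤ x) (hc : 0 ≤ c) (hy : 0 ≤ y)
    (hd : 0 ≤ d) (hz : 0 ≤ z) : √(x ^ 2 + c * y + d * z) ≤ x + √c * √y + √d * √z := by
  refine Real.sqrt_le_iff.2 ⟨by positivity, ?_⟩
  have h1 : c * y = (√c * √y) ^ 2 := by rw [mul_pow, Real.sq_sqrt hc, Real.sq_sqrt hy]
  have h2 : d * z = (√d * √z) ^ 2 := by rw [mul_pow, Real.sq_sqrt hd, Real.sq_sqrt hz]
  have h3 : 0 ≤ √c * √y := by positivity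
  have h4 : 0 ≤ √d * √z := by positivity
  rw [h1, h2]
  nlinarith [mul_nonneg hx h3, mul_nonneg hx h4, mul_nonneg h3 h4]

end ParabolicEstimate

end

/-! ### Assembly of the error bound. -/

theorem mainTheorem4 {V H : Type*}
    [NormedAddCommGroup V] [InnerProductSpace ℝ V] [CompleteSpace V]
    [NormedAddCommGroup H] [InnerProductSpace ℝ H] [CompleteSpace H]
    (S : ParabolicEstimate.Setting V H) (T : ℝ) (hT : 0 < T) (f : H) (u₀ : V)
    -- the weak solution `u` and the Galerkin approximation `ũ`
    (u : ℝ → V) (hu : S.IsWeakSolution T f u₀ u)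
    (ut : ℝ → S.Vt) (hut : S.IsGalerkinSolution T f ut)
    -- the decomposition `ũ = ũᶜ + ũᵈ`, with `ũᶜ(0) = uc₀` and `∂ₜũᵈ = ud'` in `L²(0,T;V')`
    (uc : ℝ → V) (ud : ℝ → S.Vt)
    (hdec : ∀ᵐ t ∂(ParabolicEstimate.timeMeasure T), (ut t : H) = S.ι (uc t) + ud t)
    (uc₀ : V) (huc₀ : ParabolicEstimate.HasInitialValue T (fun t => S.ι (uc t)) (S.ι uc₀))
    (hud : MemLp ud 2 (ParabolicEstimate.timeMeasure T))
    (ud' : ℝ → StrongDual ℝ V) (hud' : MemLp ud' 2 (ParabolicEstimate.timeMeasure T))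
    (hderiv : ParabolicEstimate.HasWeakTimeDeriv T (fun t => S.toDualV (ud t)) ud')
    (C : ℝ) (hC : C = √(2 * S.gamma ^ 2 + 1)) :
    S.energyL2 T (fun t => S.inV (u t) - S.inVt (ut t)) ≤
      ENNReal.ofReal ‖S.ι u₀ - S.ι uc₀‖
        + ENNReal.ofReal (√3) * S.dualEnergyL2 T ud'
        + ENNReal.ofReal (C + 1) *
            S.energyL2 T (fun t => S.inV (S.ellRec f (ut t)) - S.inVt (ut t))
        + ENNReal.ofReal C * S.energyL2 T (fun t => S.inVt (ud t)) := by
  have hut2 := hut.1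
  have huc2 := S.memLp_of_coe_eq_add hdec hut2 hud
  have hR := S.memLp_ellRec f hut2
  have hest := S.integral_sq_energy_sub_ellRec_le hT hu hut hdec huc₀ hud hud' hderiv
  have hρ := S.memLp_energy_inV (hu.1.sub hR)
  have hεc := S.memLp_energy_inV (hR.sub huc2)
  -- For `ε` and `ũᵈ` measurability suffices: the triangle inequality for `eLpNorm` holds in `ℝ≥0∞`
  -- without finiteness.
  have hεm : AEStronglyMeasurable (fun t => S.energy (S.inV (S.ellRec f (ut t)) - S.inVt (ut t)))
      (ParabolicEstimate.timeMeasure T) :=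
    S.continuous_energy_sub.comp_aestronglyMeasurable (hR.1.prodMk hut2.1)
  have hdm : AEStronglyMeasurable (fun t => S.energy (S.inVt (ud t)))
      (ParabolicEstimate.timeMeasure T) :=
    S.continuous_energy_inVt.comp_aestronglyMeasurable hud.1
  -- `e = ρ + ε`
  have h1 : S.energyL2 T (fun t => S.inV (u t) - S.inVt (ut t)) ≤
      S.energyL2 T (fun t => S.inV (u t - S.ellRec f (ut t))) +
        S.energyL2 T (fun t => S.inV (S.ellRec f (ut t)) - S.inVt (ut t)) := by
    refine le_trans (eLpNorm_mono_real fun t => ?_) (eLpNorm_add_le hρ.1 hεm one_le_two)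
    rw [Real.norm_of_nonneg (apply_nonneg _ _)]
    refine le_trans (le_of_eq ?_) (map_add_le_add S.energy _ _)
    simp only [map_sub, sub_add_sub_cancel]
  -- `R_ell(ũ) - ũᶜ = ε + ũᵈ`
  have h2 : S.energyL2 T (fun t => S.inV (S.ellRec f (ut t) - uc t)) ≤
      S.energyL2 T (fun t => S.inV (S.ellRec f (ut t)) - S.inVt (ut t)) +
        S.energyL2 T (fun t => S.inVt (ud t)) := by
    refine le_trans (eLpNorm_mono_ae_real ?_) (eLpNorm_add_le hεm hdm one_le_two)
    filter_upwards [hdec] with t ht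
    rw [Real.norm_of_nonneg (apply_nonneg _ _)]
    refine le_trans (le_of_eq ?_) (map_add_le_add S.energy _ _)
    congr 1
    refine Subtype.ext ?_
    simp [ht, sub_add_eq_sub_sub]
  -- The square root of the integrated estimate for `ρ`. The three norms are finite, so the
  -- inequality reduces to one between real numbers.
  have h3 : S.energyL2 T (fun t => S.inV (u t - S.ellRec f (ut t))) ≤
      ENNReal.ofReal ‖S.ι u₀ - S.ι uc₀‖ + ENNReal.ofReal (√3) * S.dualEnergyL2 T ud' +
        ENNReal.ofReal C * S.energyL2 T (fun t => S.inV (S.ellRec f (ut t) - uc t)) := by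
    have e1 := ParabolicEstimate.eLpNorm_two_eq_ofReal_sqrt hρ
    have e2 := ParabolicEstimate.eLpNorm_two_eq_ofReal_sqrt hεc
    have e3 := ParabolicEstimate.eLpNorm_two_eq_ofReal_sqrt (S.memLp_dualEnergy hud')
    simp only [Pi.sub_apply] at e1 e2
    rw [ParabolicEstimate.Setting.energyL2, ParabolicEstimate.Setting.energyL2,
      ParabolicEstimate.Setting.dualEnergyL2, e1, e2, e3, ← ENNReal.ofReal_mul (by positivity),
      ← ENNReal.ofReal_mul (by rw [hC]; positivity),
      ← ENNReal.ofReal_add (by positivity) (by positivity),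
      ← ENNReal.ofReal_add (by positivity) (by rw [hC]; positivity), hC]
    exact ENNReal.ofReal_le_ofReal ((Real.sqrt_le_sqrt hest).trans
      (ParabolicEstimate.sqrt_add_mul_add_mul_le (norm_nonneg _) (by norm_num)
        (integral_nonneg fun t => sq_nonneg _) (by positivity)
        (integral_nonneg fun t => sq_nonneg _)))
  have hC0 : 0 ≤ C := by rw [hC]; positivity
  rw [ENNReal.ofReal_add hC0 zero_le_one, ENNReal.ofReal_one, add_mul, one_mul]
  calc _ ≤ _ := h1
    _ ≤ _ := add_le_add_left (h3.trans (add_le_add_right (mul_le_mul_right h2 _) _)) _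
    _ = _ := by rw [mul_add]; ring
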